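/- All logarithms are binary and all graphs are simple and undirected. For a graph $G$ on a finite vertex set $V$, write $u\simeq v$ if $u,v\in V$ are equal or adjacent. The strong power $G^{\boxtimes n}$ has vertex set $V^n$, two distinct tuples $(u_i)$, $(v_i)$ being adjacent when $u_i\simeq v_i$ for all $i$. Let $\ell\ge 1$ be an integer. The compound independence number of $n$ uses of the channel with confusability graph $G$ and $\ell$ receivers is the maximum size $\alpha_{1,\ell}(G^{\boxtimes n})$ of a subset of $V^n$ that is independent in the graph $G^{\boxtimes n}$ of each of the $\ell$ (identical) receivers; the compound Shannon capacity is $c_{1,\ell}(G)=\lim_{n\to\infty}\frac1n\log\alpha_{1,\ell}(G^{\boxtimes n})$. The entanglement-assisted compound independence number $\alpha^*_{1,\ell}(G)$ is the maximum $m\in\mathbb N$ for which there are a finite-dimensional Hilbert space $\mathcal H$ and positive semidefinite operators $\rho$ and $\rho_i^u$ ($i\in[m]$, $u\in V$) on $\mathcal H^{\otimes \ell}$ such that $\operatorname{Tr}\rho=1$, $\sum_{u\in V}\rho_i^u=\rho$ for all $i\in[m]$, and $$\operatorname{Tr}_{B_{-r}}(\rho_i^u)\,\operatorname{Tr}_{B_{-r}}(\rho_j^v)=0\qquad\text{for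 all } r\in[\ell],\ i\neq j\in[m],\ u\simeq v,$$ where $\operatorname{Tr}_{B_{-r}}$ is the partial trace over all tensor factors but the $r$-th. The entanglement-assisted compound Shannon capacity is $c^*_{1,\ell}(G)=\lim_{n\to\infty}\frac1n\log\alpha^*_{1,\ell}(G^{\boxtimes n})$. For odd $k\geq 1$, the quarter orthogonality graph $\Gamma_k$ has as vertices the vectors $u\in\{\pm1\}^{k+1}$ with $u_1=1$ and an even number of entries $-1$; two vertices are adjacent when they are orthogonal. **Statement.** (1) Let $k=4p^s-1$ with $p$ an odd prime and $s\ge 0$ an integer, and let $\ell\ge1$ be an integer. If $$\ell<\frac{0.144\,k-1}{0.856\,k}\left\lfloor\frac{k-3}{4\log(k+1)}\right\rfloor,$$ then the capacities $c_{1,\ell}(\Gamma_k)$ and $c^*_{1,\ell}(\Gamma_k)$ exist (the maxima and limits above exist and are finite) and $c^*_{1,\ell}(\Gamma_k)>c_{1,\ell}(\Gamma_k)$. (2) Consequently, for every integer $\ell\ge1$ there are an odd prime $p$ and an integer $s\ge1$ such that, with $k=4p^s-1$, these capacities exist and $c^*_{1,\ell}(\Gamma_k)>c_{1,\ell}(\Gamma_k)$.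 -/

import Mathlib

open scoped ComplexOrder

namespace ZeroError

/-- The strong power `G^{⊠ n}`: vertices are `n`-tuples, and two distinct tuples are adjacent
when in each coordinate they are equal or adjacent in `G`. -/
def strongPower {V : Type*} (G : SimpleGraph V) (n : ℕ) : SimpleGraph (Fin n → V) where
  Adj u v := u ≠ v ∧ ∀ i, u i = v i ∨ G.Adj (u i) (v i)
  symm := ⟨fun _ _ h => ⟨h.1.symm, fun i => (h.2 i).imp Eq.symm (fun h' => h'.symm)⟩⟩
  loopless := ⟨fun _ h => h.1 rfl⟩

/-- `a = α(𝒢, n)` for a family `𝒢` of graphs on the common vertex set `V`: the maximum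
cardinality of a set of `n`-tuples that is independent in the `n`-th strong power of every
member of the family. -/
def IsFamilyIndepNum {V ι : Type*} (𝒢 : ι → SimpleGraph V) (n a : ℕ) : Prop :=
  IsGreatest {m : ℕ | ∃ S : Finset (Fin n → V), S.card = m ∧
    ∀ k, (strongPower (𝒢 k) n).IsIndepSet (S : Set (Fin n → V))} a

/-- `c = c(𝒢)`: the Shannon capacity `lim (1/n) log₂ α(𝒢, n)` of the family `𝒢`. -/
def IsFamilyCapacity {V ι : Type*} (𝒢 : ι → SimpleGraph V) (c : ℝ) : Prop :=
  ∃ a : ℕ → ℕ, (∀ n, IsFamilyIndepNum 𝒢 n (a n)) ∧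
    Filter.Tendsto (fun n : ℕ => (1 / (n : ℝ)) * Real.logb 2 (a n)) Filter.atTop (nhds c)

/-- `c = c_{1,ℓ}(G)`: the compound Shannon capacity with `ℓ` receivers, all of whose channels
have confusability graph `G`. -/
def IsCompoundCapacity {V : Type*} (ℓ : ℕ) (G : SimpleGraph V) (c : ℝ) : Prop :=
  IsFamilyCapacity (fun _ : Fin ℓ => G) c

/-- The partial trace of an operator on `(ℂ^d)^{⊗ ℓ}` over all tensor factors but the `k`-th.
The standard basis of `(ℂ^d)^{⊗ ℓ}` is indexed by `Fin ℓ → Fin d`; the entry at `(a, b)` is the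
sum of `M x y` over the index pairs with `x k = a`, `y k = b` and `x j = y j` for `j ≠ k`. -/
def reduce {ℓ d : ℕ} (k : Fin ℓ) (M : Matrix (Fin ℓ → Fin d) (Fin ℓ → Fin d) ℂ) :
    Matrix (Fin d) (Fin d) ℂ :=
  Matrix.of fun a b => ∑ x : Fin ℓ → Fin d, if x k = a then M x (Function.update x k b) else 0

/-- There are operators `ρ_i^u` (`i ∈ [m]`, `u ∈ V`) and `ρ` on some `(ℂ^d)^{⊗ ℓ}` that witness
`m` messages for the entanglement-assisted compound channel with confusability graph `G`. -/
def EntangledAchievable {V : Type*} [Fintype V] (ℓ : ℕ) (G : SimpleGraph V) (m : ℕ) : Prop :=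
  ∃ (d : ℕ) (R : Fin m → V → Matrix (Fin ℓ → Fin d) (Fin ℓ → Fin d) ℂ)
    (ρ : Matrix (Fin ℓ → Fin d) (Fin ℓ → Fin d) ℂ),
    (∀ i u, (R i u).PosSemidef) ∧ ρ.PosSemidef ∧
    ρ.trace = 1 ∧
    (∀ i, ∑ u, R i u = ρ) ∧
    (∀ (k : Fin ℓ) (i j : Fin m), i ≠ j → ∀ u v : V, (u = v ∨ G.Adj u v) →
      reduce k (R i u) * reduce k (R j v) = 0)

/-- `a = α*_{1,ℓ}(G)`: the entanglement-assisted compound independence number. -/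
def IsEntangledIndepNum {V : Type*} [Fintype V] (ℓ : ℕ) (G : SimpleGraph V) (a : ℕ) : Prop :=
  IsGreatest {m : ℕ | EntangledAchievable ℓ G m} a

/-- `c = c*_{1,ℓ}(G)`: the entanglement-assisted compound Shannon capacity,
`lim (1/n) log₂ α*_{1,ℓ}(G^{⊠ n})`. -/
def IsEntangledCapacity {V : Type*} [Fintype V] (ℓ : ℕ) (G : SimpleGraph V) (c : ℝ) : Prop :=
  ∃ a : ℕ → ℕ, (∀ n, IsEntangledIndepNum ℓ (strongPower G n) (a n)) ∧
    Filter.Tendsto (fun n : ℕ => (1 / (n : ℝ)) * Real.logb 2 (a n)) Filter.atTop (nhds c)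

/-- Vertices of the quarter orthogonality graph: vectors in `{±1}^{k+1}` with first entry `1`
and an even number of entries `-1` (here `{±1}` is the group of units of `ℤ`). -/
abbrev QuarterVertex (k : ℕ) : Type :=
  {u : Fin (k + 1) → ℤˣ // u 0 = 1 ∧ Even (Finset.univ.filter fun i => u i = -1).card}

/-- The quarter orthogonality graph `Γ_k`: vertices are adjacent when they are orthogonal. -/
def quarterGraph (k : ℕ) : SimpleGraph (QuarterVertex k) where
  Adj u v := ∑ i, ((u.1 i : ℤ) * (v.1 i : ℤ)) = 0
  symm := ⟨fun u v h => by simpa only [mul_comm] using h⟩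
  loopless := ⟨fun u h => by
    have h1 : ∀ i, ((u.1 i : ℤ) * (u.1 i : ℤ)) = 1 := fun i => by
      rw [← Units.val_mul, Int.units_mul_self, Units.val_one]
    simp only [h1, Finset.sum_const, Finset.card_univ, Fintype.card_fin, nsmul_eq_mul] at h
    omega⟩

end ZeroError

/-! ### Growth rates, strong powers and Haemers' rank bound. -/

namespace ZeroError

/-! Write `q = p ^ s`, so `k + 1 = 4 q`, and let `e` be half the Hamming distance of two vertices;
they are orthogonal exactly when `e = q`.

Classical upper bound: the matrix with entries `(e - 1).choose (q - 1)` is `±1` on the diagonal and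
divisible by `p` at distinct nonadjacent pairs. Its entries are polynomials of degree at most `q -
1` in the signs, so its rational rank is at most the number of subsets of `Fin k` of size at most `q
- 1`, and Haemers' argument gives `c ≤ 0.856 k` (`indepSet_card_le`, `logb_card_lowDegree_le`).

Entangled lower bound: the sender is maximally entangled with every receiver. To send `w ∈ V ^ N`,
one measures each of the `ℓ` systems in a basis made from `w` by twisting with characters, transmits
`w` in `N` uses, and transmits the `ℓ` outcomes in `ℓ` more uses through an independent set. Inputs
confusable for different messages carry equal outcomes and orthogonal vectors
(`EntangledAchievable.of_representation`). An independent set of size `2 ^ ((k - 3) / 4)` allows `N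
= ⌊(k - 3) / (4 log (k + 1))⌋`, hence the rate `N (k - 1) / (N + ℓ)`; it exceeds `0.856 k` exactly
under the hypothesis on `ℓ`.

Both limits exist by Fekete's lemma. -/

/-- Fekete's lemma for the maxima of a supermultiplicative sequence of sets of natural numbers
of exponential growth. -/
theorem exists_growth_rate (A : ℕ → Set ℕ) (B : ℕ) (hB : ∀ n, ∀ x ∈ A n, x ≤ B ^ n)
    (h1 : ∀ n, 1 ∈ A n) (hmul : ∀ m n x y, x ∈ A m → y ∈ A n → x * y ∈ A (m + n)) :
    ∃ c : ℝ, (∃ a : ℕ → ℕ, (∀ n, IsGreatest (A n) (a n)) ∧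
        Filter.Tendsto (fun n : ℕ => (1 / (n : ℝ)) * Real.logb 2 (a n)) Filter.atTop (nhds c)) ∧
      c ≤ Real.logb 2 B ∧ ∀ n x, n ≠ 0 → x ∈ A n → 1 ≤ x → Real.logb 2 x / n ≤ c := by
  have hbdd : ∀ n, BddAbove (A n) := fun n => ⟨B ^ n, hB n⟩
  have hgr : ∀ n, IsGreatest (A n) (sSup (A n)) := fun n =>
    ⟨Nat.sSup_mem ⟨1, h1 n⟩ (hbdd n), fun x hx => le_csSup (hbdd n) hx⟩
  set a : ℕ → ℕ := fun n => sSup (A n) with ha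
  have ha1 : ∀ n, 1 ≤ a n := fun n => (hgr n).2 (h1 n)
  have hapos : ∀ n, (0 : ℝ) < a n := fun n => by exact_mod_cast ha1 n
  have hlog : ∀ n, Real.logb 2 (a n) ≤ n * Real.logb 2 B := fun n => by
    rw [← Real.logb_pow]
    refine Real.logb_le_logb_of_le one_lt_two (hapos n) ?_
    exact_mod_cast hB n _ (hgr n).1
  have hsub : Subadditive fun n => -Real.logb 2 (a n) := fun m n => by
    have h : ((a m * a n : ℕ) : ℝ) ≤ a (m + n) := by
      exact_mod_cast (hgr (m + n)).2 (hmul m n _ _ (hgr m).1 (hgr n).1)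
    have h2 := Real.logb_le_logb_of_le one_lt_two (by push_cast; exact mul_pos (hapos m) (hapos n)) h
    rw [Nat.cast_mul, Real.logb_mul (hapos m).ne' (hapos n).ne'] at h2
    linarith
  have hB1 : 0 ≤ Real.logb 2 B := by
    have := hlog 1
    have h0 : 0 ≤ Real.logb 2 (a 1) :=
      Real.logb_nonneg one_lt_two (by exact_mod_cast ha1 1)
    simpa using h0.trans this
  have hdiv : ∀ n : ℕ, -Real.logb 2 B ≤ -Real.logb 2 (a n) / n := fun n => by
    -- At `n = 0` the quotient is `0` by convention, so `hB1` is needed.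
    rcases Nat.eq_zero_or_pos n with rfl | hn
    · simpa using hB1
    · rw [le_div_iff₀ (by exact_mod_cast hn)]
      linarith [hlog n]
  have hb : BddBelow (Set.range fun n : ℕ => -Real.logb 2 (a n) / n) :=
    ⟨-Real.logb 2 B, by rintro _ ⟨n, rfl⟩; exact hdiv n⟩
  refine ⟨-hsub.lim, ⟨a, hgr, ?_⟩, ?_, ?_⟩
  · refine (hsub.tendsto_lim hb).neg.congr fun n => ?_
    ring
  · have := ge_of_tendsto' (hsub.tendsto_lim hb) hdiv
    linarith
  · intro n x hn hx hx1
    have h := hsub.lim_le_div hb hn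
    have h2 : Real.logb 2 x ≤ Real.logb 2 (a n) :=
      Real.logb_le_logb_of_le one_lt_two (by exact_mod_cast hx1) (by exact_mod_cast (hgr n).2 hx)
    have h3 : Real.logb 2 x / n ≤ Real.logb 2 (a n) / n := by gcongr
    rw [neg_div] at h
    linarith

/-- Allowing equality makes the relation purely coordinatewise, hence compatible with concatenation
of tuples. -/
theorem eq_or_strongPower_adj {V : Type*} (G : SimpleGraph V) {n : ℕ} (x y : Fin n → V) :
    (x = y ∨ (strongPower G n).Adj x y) ↔ ∀ i, x i = y i ∨ G.Adj (x i) (y i) := by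
  constructor
  · rintro (rfl | h) i
    · exact Or.inl rfl
    · exact h.2 i
  · intro h
    by_cases hxy : x = y
    · exact Or.inl hxy
    · exact Or.inr ⟨hxy, h⟩

theorem eq_or_strongPower_adj_append {V : Type*} (G : SimpleGraph V) {m n : ℕ}
    (x x' : Fin m → V) (y y' : Fin n → V) :
    (Fin.append x y = Fin.append x' y' ∨
        (strongPower G (m + n)).Adj (Fin.append x y) (Fin.append x' y')) ↔
      (x = x' ∨ (strongPower G m).Adj x x') ∧ (y = y' ∨ (strongPower G n).Adj y y') := by
  simp only [eq_or_strongPower_adj, Fin.forall_fin_add, Fin.append_left, Fin.append_right]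

theorem isIndepSet_iff_of_eq_or_adj {V : Type*} (G : SimpleGraph V) (S : Set V) :
    G.IsIndepSet S ↔ ∀ x ∈ S, ∀ y ∈ S, (x = y ∨ G.Adj x y) → x = y := by
  constructor
  · intro h x hx y hy hxy
    by_contra hne
    exact h hx hy hne (hxy.resolve_left hne)
  · intro h x hx y hy hne hadj
    exact hne (h x hx y hy (Or.inr hadj))

theorem exists_indepSet_mul {V : Type*} (G : SimpleGraph V) {m n : ℕ}
    {S : Finset (Fin m → V)} {T : Finset (Fin n → V)}
    (hS : (strongPower G m).IsIndepSet (S : Set (Fin m → V)))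
    (hT : (strongPower G n).IsIndepSet (T : Set (Fin n → V))) :
    ∃ U : Finset (Fin (m + n) → V), U.card = S.card * T.card ∧
      (strongPower G (m + n)).IsIndepSet (U : Set (Fin (m + n) → V)) := by
  refine ⟨(S ×ˢ T).map (Fin.appendEquiv m n).toEmbedding, by simp, ?_⟩
  rw [isIndepSet_iff_of_eq_or_adj] at *
  simp only [Finset.coe_map, Equiv.coe_toEmbedding, Set.mem_image, Finset.mem_coe,
    Finset.mem_product]
  rintro _ ⟨⟨x, y⟩, ⟨hx, hy⟩, rfl⟩ _ ⟨⟨x', y'⟩, ⟨hx', hy'⟩, rfl⟩ h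
  have h' := (eq_or_strongPower_adj_append G x x' y y').1 h
  rw [hS x hx x' hx' h'.1, hT y hy y' hy' h'.2]

/-- Haemers' bound for an integer matrix that factors through dimension `r` over `ℚ` and is
diagonal modulo `p`, with nonzero diagonal entries, on independent sets. -/
theorem card_le_pow_of_factorization {V C : Type*} [Fintype C] (G : SimpleGraph V) (p : ℕ)
    [Fact p.Prime] (M : V → V → ℤ) (X : V → C → ℚ) (Y : C → V → ℚ)
    (hfac : ∀ u v, (M u v : ℚ) = ∑ c, X u c * Y c v)
    (hdiag : ∀ u, ¬ (p : ℤ) ∣ M u u)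
    (hoff : ∀ u v, u ≠ v → ¬ G.Adj u v → (p : ℤ) ∣ M u v)
    {n : ℕ} {S : Finset (Fin n → V)}
    (hS : (strongPower G n).IsIndepSet (S : Set (Fin n → V))) :
    S.card ≤ Fintype.card C ^ n := by
  classical
  rw [isIndepSet_iff_of_eq_or_adj] at hS
  let Q : Matrix S S ℤ := Matrix.of fun u v => ∏ t, M (u.1 t) (v.1 t)
  let X' : Matrix S (Fin n → C) ℚ := Matrix.of fun u c => ∏ t, X (u.1 t) (c t)
  let Y' : Matrix (Fin n → C) S ℚ := Matrix.of fun c v => ∏ t, Y (c t) (v.1 t)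
  -- `Q` is a submatrix of the `n`-fold Kronecker power of `M`, so the factorization also takes its
  -- power.
  have hQ : Q.map (Int.castRingHom ℚ) = X' * Y' := by
    ext u v
    simp only [Q, X', Y', Matrix.map_apply, Matrix.of_apply, Matrix.mul_apply, eq_intCast,
      Int.cast_prod, hfac, ← Finset.prod_mul_distrib]
    rw [Finset.prod_univ_sum, Fintype.piFinset_univ]
  have hQp : Q.map (Int.castRingHom (ZMod p)) =
      Matrix.diagonal fun u : S => ∏ t, ((M (u.1 t) (u.1 t) : ℤ) : ZMod p) := by
    ext u v
    by_cases huv : u = v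
    · subst huv
      simp [Q]
    · rw [Matrix.diagonal_apply_ne _ huv]
      have hne : ¬ ∀ i, u.1 i = v.1 i ∨ G.Adj (u.1 i) (v.1 i) := fun h =>
        huv (Subtype.ext (hS _ u.2 _ v.2 ((eq_or_strongPower_adj G _ _).2 h)))
      push Not at hne
      obtain ⟨i, h1, h2⟩ := hne
      simp only [Q, Matrix.map_apply, Matrix.of_apply, eq_intCast, Int.cast_prod]
      exact Finset.prod_eq_zero (Finset.mem_univ i)
        ((ZMod.intCast_zmod_eq_zero_iff_dvd _ p).2 (hoff _ _ h1 h2))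
  -- Nonsingularity is seen modulo `p` but used over `ℚ`, because the factorization may have
  -- denominators divisible by `p`.
  have hdet : Q.det ≠ 0 := by
    intro h
    have h2 : (Q.map (Int.castRingHom (ZMod p))).det = 0 := by
      have := (Int.castRingHom (ZMod p)).map_det Q
      rw [h, map_zero] at this
      exact this.symm
    rw [hQp, Matrix.det_diagonal, Finset.prod_eq_zero_iff] at h2
    obtain ⟨u, -, hu⟩ := h2
    rw [Finset.prod_eq_zero_iff] at hu
    obtain ⟨t, -, ht⟩ := hu
    exact hdiag _ ((ZMod.intCast_zmod_eq_zero_iff_dvd _ p).1 ht)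
  have hunit : IsUnit (Q.map (Int.castRingHom ℚ)) := by
    rw [Matrix.isUnit_iff_isUnit_det, isUnit_iff_ne_zero]
    have := (Int.castRingHom ℚ).map_det Q
    rw [RingHom.mapMatrix_apply] at this
    rw [← this]
    simpa using hdet
  have hr := Matrix.rank_of_isUnit _ hunit
  rw [hQ] at hr
  calc S.card = (X' * Y').rank := by rw [hr, Fintype.card_coe]
    _ ≤ X'.rank := Matrix.rank_mul_le_left _ _
    _ ≤ Fintype.card (Fin n → C) := Matrix.rank_le_card_width _
    _ = Fintype.card C ^ n := by simp

end ZeroError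

/-! ### Partial traces, products of entangled protocols, and boundedness. -/

namespace ZeroError
open Matrix

/-- The partial trace of an operator on `(ℂ^D)^{⊗ ℓ}` over all tensor factors but the `k`-th,
for an arbitrary finite index type `D`. -/
def partialTrace {ℓ : ℕ} {D : Type*} [Fintype D] (k : Fin ℓ)
    (M : Matrix (Fin ℓ → D) (Fin ℓ → D) ℂ) : Matrix D D ℂ :=
  ∑ z : {j // j ≠ k} → D,
    M.submatrix (fun a => (Equiv.funSplitAt k D).symm (a, z))
      (fun b => (Equiv.funSplitAt k D).symm (b, z))

/-- As a sum of principal submatrices, the partial trace visibly preserves positivity. -/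
theorem reduce_eq_partialTrace {ℓ d : ℕ} (k : Fin ℓ)
    (M : Matrix (Fin ℓ → Fin d) (Fin ℓ → Fin d) ℂ) : reduce k M = partialTrace k M := by
  ext a b
  rw [reduce, partialTrace, Matrix.of_apply, Matrix.sum_apply,
    ← (Equiv.funSplitAt k (Fin d)).symm.sum_comp, Fintype.sum_prod_type, Finset.sum_eq_single a]
  · refine Finset.sum_congr rfl fun z _ => ?_
    have h : Function.update ((Equiv.funSplitAt k (Fin d)).symm (a, z)) k b =
        (Equiv.funSplitAt k (Fin d)).symm (b, z) := by
      ext j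
      by_cases hj : j = k
      · subst hj; simp
      · simp [hj]
    rw [h, if_pos (by simp), Matrix.submatrix_apply]
  · intro a' _ ha
    exact Finset.sum_eq_zero fun z _ => if_neg (by simpa using ha)
  · simp

theorem partialTrace_posSemidef {ℓ : ℕ} {D : Type*} [Fintype D] (k : Fin ℓ)
    {M : Matrix (Fin ℓ → D) (Fin ℓ → D) ℂ} (hM : M.PosSemidef) :
    (partialTrace k M).PosSemidef :=
  posSemidef_sum _ fun _ _ => hM.submatrix _

theorem trace_partialTrace {ℓ : ℕ} {D : Type*} [Fintype D] (k : Fin ℓ)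
    (M : Matrix (Fin ℓ → D) (Fin ℓ → D) ℂ) : (partialTrace k M).trace = M.trace := by
  rw [partialTrace, trace_sum]
  simp only [trace, diag_apply, submatrix_apply]
  rw [← (Equiv.funSplitAt k D).symm.sum_comp, Fintype.sum_prod_type, Finset.sum_comm]

theorem partialTrace_sum {ℓ : ℕ} {D ι : Type*} [Fintype D] (k : Fin ℓ) (s : Finset ι)
    (M : ι → Matrix (Fin ℓ → D) (Fin ℓ → D) ℂ) :
    partialTrace k (∑ i ∈ s, M i) = ∑ i ∈ s, partialTrace k (M i) := by
  ext a b
  simp only [partialTrace, Matrix.sum_apply, submatrix_apply]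
  exact Finset.sum_comm

theorem partialTrace_submatrix_equiv {ℓ : ℕ} {D E : Type*} [Fintype D] [Fintype E] (k : Fin ℓ)
    (e : E ≃ D) (M : Matrix (Fin ℓ → D) (Fin ℓ → D) ℂ) :
    partialTrace k (M.submatrix (fun x => e ∘ x) (fun x => e ∘ x)) =
      (partialTrace k M).submatrix e e := by
  ext a b
  simp only [partialTrace, Matrix.sum_apply, submatrix_apply]
  have h : ∀ (a : E) (z : {j // j ≠ k} → E), e ∘ (Equiv.funSplitAt k E).symm (a, z) =
      (Equiv.funSplitAt k D).symm (e a, e ∘ z) := by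
    intro a z
    ext j
    by_cases hj : j = k
    · subst hj; simp
    · simp [hj]
  simp only [h]
  exact (Equiv.arrowCongr (Equiv.refl _) e).sum_comp
    (fun z => M ((Equiv.funSplitAt k D).symm (e a, z)) ((Equiv.funSplitAt k D).symm (e b, z)))

/-- The tensor product of operators on `(ℂ^D)^{⊗ ℓ}` and `(ℂ^E)^{⊗ ℓ}` as an operator on
`(ℂ^{D × E})^{⊗ ℓ}`. -/
def tensor {ℓ : ℕ} {D E : Type*} (M : Matrix (Fin ℓ → D) (Fin ℓ → D) ℂ)
    (N : Matrix (Fin ℓ → E) (Fin ℓ → E) ℂ) :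
    Matrix (Fin ℓ → D × E) (Fin ℓ → D × E) ℂ :=
  (kroneckerMap (· * ·) M N).submatrix (Equiv.arrowProdEquivProdArrow _ _ _)
    (Equiv.arrowProdEquivProdArrow _ _ _)

theorem partialTrace_tensor {ℓ : ℕ} {D E : Type*} [Fintype D] [Fintype E] (k : Fin ℓ)
    (M : Matrix (Fin ℓ → D) (Fin ℓ → D) ℂ) (N : Matrix (Fin ℓ → E) (Fin ℓ → E) ℂ) :
    partialTrace k (tensor M N) =
      kroneckerMap (· * ·) (partialTrace k M) (partialTrace k N) := by
  ext ⟨a, a'⟩ ⟨b, b'⟩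
  simp only [partialTrace, tensor, Matrix.sum_apply, submatrix_apply, kroneckerMap_apply]
  rw [Fintype.sum_mul_sum, ← Fintype.sum_prod_type',
    ← (Equiv.arrowProdEquivProdArrow _ (fun _ => D) (fun _ => E)).sum_comp]
  refine Finset.sum_congr rfl fun z _ => ?_
  have h : ∀ (a : D) (a' : E), Equiv.arrowProdEquivProdArrow (Fin ℓ) (fun _ => D) (fun _ => E)
      ((Equiv.funSplitAt k (D × E)).symm ((a, a'), z)) =
      ((Equiv.funSplitAt k D).symm (a, fun j => (z j).1),
        (Equiv.funSplitAt k E).symm (a', fun j => (z j).2)) := by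
    intro a a'
    ext j <;> by_cases hj : j = k
    · subst hj; simp [Equiv.arrowProdEquivProdArrow]
    · simp [hj, Equiv.arrowProdEquivProdArrow]
    · subst hj; simp [Equiv.arrowProdEquivProdArrow]
    · simp [hj, Equiv.arrowProdEquivProdArrow]
  rw [h, h]
  rfl

theorem EntangledAchievable.of_fintype {V I D : Type*} [Fintype V] [Fintype I] [Fintype D] (ℓ : ℕ)
    (G : SimpleGraph V) (R : I → V → Matrix (Fin ℓ → D) (Fin ℓ → D) ℂ)
    (ρ : Matrix (Fin ℓ → D) (Fin ℓ → D) ℂ) (hR : ∀ i u, (R i u).PosSemidef)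
    (hρ : ρ.PosSemidef) (htr : ρ.trace = 1) (hsum : ∀ i, ∑ u, R i u = ρ)
    (horth : ∀ (k : Fin ℓ) (i j : I), i ≠ j → ∀ u v : V, (u = v ∨ G.Adj u v) →
      partialTrace k (R i u) * partialTrace k (R j v) = 0) :
    EntangledAchievable ℓ G (Fintype.card I) := by
  classical
  let e := (Fintype.equivFin D).symm
  let f := (Fintype.equivFin I).symm
  let e' : (Fin ℓ → Fin (Fintype.card D)) ≃ (Fin ℓ → D) := Equiv.arrowCongr (Equiv.refl _) e
  refine ⟨Fintype.card D, fun i u => (R (f i) u).submatrix e' e', ρ.submatrix e' e',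
    fun i u => (hR _ _).submatrix _, hρ.submatrix _, ?_, ?_, ?_⟩
  · rw [← htr]
    exact e'.sum_comp fun x => ρ x x
  · intro i
    rw [← hsum (f i)]
    ext x y
    simp [Matrix.sum_apply]
  · intro k i j hij u v huv
    rw [reduce_eq_partialTrace, reduce_eq_partialTrace]
    have h := partialTrace_submatrix_equiv k e
    have h2 : (e' : (Fin ℓ → Fin (Fintype.card D)) → (Fin ℓ → D)) = fun x => e ∘ x := rfl
    rw [h2, h, h, submatrix_mul_equiv, horth k _ _ (f.injective.ne hij) u v huv]
    rfl

/-- Two protocols run independently: distinct message pairs differ in one component, and that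
Kronecker factor of the product already vanishes. -/
theorem EntangledAchievable.mul {V : Type*} [Fintype V] {ℓ : ℕ} {G : SimpleGraph V} {m n a b : ℕ}
    (ha : EntangledAchievable ℓ (strongPower G m) a)
    (hb : EntangledAchievable ℓ (strongPower G n) b) :
    EntangledAchievable ℓ (strongPower G (m + n)) (a * b) := by
  obtain ⟨d, R, ρ, hR, hρ, htr, hsum, horth⟩ := ha
  obtain ⟨d', R', ρ', hR', hρ', htr', hsum', horth'⟩ := hb
  have key := EntangledAchievable.of_fintype (I := Fin a × Fin b) (D := Fin d × Fin d') ℓ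
    (strongPower G (m + n))
    (fun i u => tensor (R i.1 ((Fin.appendEquiv m n).symm u).1)
      (R' i.2 ((Fin.appendEquiv m n).symm u).2)) (tensor ρ ρ')
    (fun i u => ((hR _ _).kronecker (hR' _ _)).submatrix _) ((hρ.kronecker hρ').submatrix _)
    ?_ ?_ ?_
  · simpa using key
  · have h := trace_kronecker ρ ρ'
    rw [htr, htr', one_mul] at h
    rw [← h]
    exact (Equiv.arrowProdEquivProdArrow _ _ _).sum_comp
      fun x => (kroneckerMap (· * ·) ρ ρ') x x
  · rintro ⟨i, j⟩
    rw [← (Fin.appendEquiv m n).sum_comp, Fintype.sum_prod_type]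
    simp only [Equiv.symm_apply_apply]
    rw [← hsum i, ← hsum' j]
    ext x y
    simp only [tensor, Matrix.sum_apply, submatrix_apply, kroneckerMap_apply, Fintype.sum_mul_sum]
  · rintro k ⟨i, j⟩ ⟨i', j'⟩ hij u v huv
    obtain ⟨⟨x, y⟩, rfl⟩ := (Fin.appendEquiv m n).surjective u
    obtain ⟨⟨x', y'⟩, rfl⟩ := (Fin.appendEquiv m n).surjective v
    have h := (eq_or_strongPower_adj_append G x x' y y').1 huv
    simp only [Equiv.symm_apply_apply, partialTrace_tensor]
    rw [← mul_kronecker_mul]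
    by_cases hi : i = i'
    · have hj : j ≠ j' := fun hj => hij (by rw [hi, hj])
      have := horth' k j j' hj _ _ h.2
      rw [reduce_eq_partialTrace, reduce_eq_partialTrace] at this
      rw [this, kroneckerMap_zero_right _ fun a => mul_zero a]
    · have := horth k i i' hi _ _ h.1
      rw [reduce_eq_partialTrace, reduce_eq_partialTrace] at this
      rw [this, kroneckerMap_zero_left _ fun a => zero_mul a]

theorem EntangledAchievable.one {V : Type*} [Fintype V] [Nonempty V] (ℓ : ℕ) (G : SimpleGraph V) :
    EntangledAchievable ℓ G 1 := by
  classical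
  have u₀ : V := Classical.arbitrary V
  have key := EntangledAchievable.of_fintype (I := Unit) (D := Unit) ℓ G
    (fun _ u => if u = u₀ then 1 else 0) 1 ?_ PosSemidef.one ?_ ?_ ?_
  · simpa using key
  · intro i u
    split_ifs
    · exact PosSemidef.one
    · exact PosSemidef.zero
  · simp
  · simp
  · intro k i j hij
    exact absurd (Subsingleton.elim i j) hij

/-- A Hermitian matrix has a support projection, which is a multiple of it on either side. -/
theorem exists_support_projection {D : Type*} [Fintype D] {A : Matrix D D ℂ} (hA : A.IsHermitian) :
    ∃ P B : Matrix D D ℂ, P.IsHermitian ∧ P * P = P ∧ P * A = A ∧ P = A * B ∧ P = B * A := by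
  classical
  let U := hA.eigenvectorUnitary
  let φ := Unitary.conjStarAlgAut ℂ (Matrix D D ℂ) U
  let ev : D → ℂ := RCLike.ofReal ∘ hA.eigenvalues
  have hA' : A = φ (diagonal ev) := hA.spectral_theorem
  have hmul : ∀ f g : D → ℂ, φ (diagonal f) * φ (diagonal g) = φ (diagonal fun i => f i * g i) := by
    intro f g
    rw [← map_mul, diagonal_mul_diagonal]
  -- Since `0⁻¹ = 0`, the first diagonal is the indicator of the nonzero eigenvalues.
  refine ⟨φ (diagonal fun i => ev i * (ev i)⁻¹), φ (diagonal fun i => (ev i)⁻¹), ?_, ?_, ?_, ?_, ?_⟩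
  · rw [IsHermitian, ← star_eq_conjTranspose, ← map_star, star_eq_conjTranspose,
      diagonal_conjTranspose]
    congr 2
    ext i
    simp [ev]
  · rw [hmul]
    congr 2
    ext i
    by_cases h : ev i = 0 <;> simp [h]
  · conv_lhs => rw [hA']
    conv_rhs => rw [hA']
    rw [hmul]
    congr 2
    ext i
    by_cases h : ev i = 0 <;> simp [h]
  · conv_rhs => rw [hA']
    rw [hmul]
  · conv_rhs => rw [hA']
    rw [hmul]
    simp only [mul_comm]

theorem trace_projection_mul_nonneg {D : Type*} [Fintype D] {P σ : Matrix D D ℂ}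
    (hP : P.IsHermitian) (hPP : P * P = P) (hσ : σ.PosSemidef) : 0 ≤ (P * σ).trace := by
  have h := (hσ.mul_mul_conjTranspose_same P).trace_nonneg
  rw [hP.eq, trace_mul_comm, ← mul_assoc, hPP] at h
  exact h

/-- Mutually orthogonal positive semidefinite operators below `σ` have total trace at most
`tr σ`. -/
theorem sum_trace_le_of_orthogonal {D I : Type*} [Fintype D] [Fintype I] {A : I → Matrix D D ℂ}
    {σ : Matrix D D ℂ} (hA : ∀ i, (A i).PosSemidef) (hσ : σ.PosSemidef)
    (hle : ∀ i, (σ - A i).PosSemidef) (horth : ∀ i j, i ≠ j → A i * A j = 0) :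
    ∑ i, (A i).trace ≤ σ.trace := by
  classical
  choose P B hP hPP hPA hAB hBA using fun i => exists_support_projection (hA i).isHermitian
  have hPij : ∀ i j, i ≠ j → P i * P j = 0 := fun i j hij => by
    rw [hBA i, hAB j, mul_assoc, ← mul_assoc (A i), horth i j hij]
    simp
  have h1 : ∀ i, (A i).trace ≤ (P i * σ).trace := fun i => by
    have h := trace_projection_mul_nonneg (hP i) (hPP i) (hle i)
    rw [mul_sub, trace_sub, hPA] at h
    exact sub_nonneg.1 h
  -- The complement of the orthogonal supports is a projection too, so the `tr (P i * σ)` sum to at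
  -- most `tr σ`.
  have hQ : (1 - ∑ i, P i).IsHermitian := by
    rw [IsHermitian, conjTranspose_sub, conjTranspose_one, conjTranspose_sum]
    simp only [fun i => (hP i).eq]
  have hS : (∑ i, P i) * (∑ i, P i) = ∑ i, P i := by
    rw [Finset.sum_mul_sum]
    refine Finset.sum_congr rfl fun i _ => ?_
    rw [Finset.sum_eq_single i (fun j _ hj => hPij i j hj.symm) (by simp), hPP]
  have hQQ : (1 - ∑ i, P i) * (1 - ∑ i, P i) = 1 - ∑ i, P i := by
    rw [mul_sub, mul_one, sub_mul, hS, one_mul]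
    simp
  have h2 := trace_projection_mul_nonneg hQ hQQ hσ
  rw [sub_mul, trace_sub, one_mul, Finset.sum_mul, trace_sum] at h2
  exact (Finset.sum_le_sum fun i _ => h1 i).trans (sub_nonneg.1 h2)

/-- One receiver suffices: for fixed `u` the reduced operators of different messages are orthogonal
and lie below the reduced `ρ`, so their traces sum to at most `1`. Summed over `u`, each message
contributes exactly `1`. -/
theorem EntangledAchievable.le_card {V : Type*} [Fintype V] {ℓ : ℕ} (hℓ : 1 ≤ ℓ) {G : SimpleGraph V}
    {m : ℕ} (h : EntangledAchievable ℓ G m) : m ≤ Fintype.card V := by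
  classical
  obtain ⟨d, R, ρ, hR, hρ, htr, hsum, horth⟩ := h
  let k : Fin ℓ := ⟨0, hℓ⟩
  let A : Fin m → V → Matrix (Fin d) (Fin d) ℂ := fun i u => partialTrace k (R i u)
  have hA : ∀ i u, (A i u).PosSemidef := fun i u => partialTrace_posSemidef k (hR i u)
  have hAs : ∀ i, ∑ u, A i u = partialTrace k ρ := fun i => by
    rw [← hsum i, partialTrace_sum]
  have h1 : ∀ u, ∑ i, (A i u).trace ≤ 1 := fun u => by
    rw [← htr, ← trace_partialTrace k]
    refine sum_trace_le_of_orthogonal (fun i => hA i u) (partialTrace_posSemidef k hρ) ?_ ?_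
    · intro i
      rw [← hAs i, ← Finset.sum_erase_eq_sub (Finset.mem_univ u)]
      exact posSemidef_sum _ fun v _ => hA i v
    · intro i j hij
      have := horth k i j hij u u (Or.inl rfl)
      rwa [reduce_eq_partialTrace, reduce_eq_partialTrace] at this
  have h2 : ∑ u, ∑ i, (A i u).trace = m := by
    rw [Finset.sum_comm]
    simp only [← trace_sum, hAs, trace_partialTrace, htr]
    simp
  have h3 : (m : ℂ) ≤ (Fintype.card V : ℂ) := by
    rw [← h2]
    refine (Finset.sum_le_sum fun u _ => h1 u).trans ?_
    simp
  exact_mod_cast h3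

end ZeroError

/-! ### Haemers matrix, size and independent sets of the quarter orthogonality graph. -/

namespace ZeroError

/-- The number of entries `-1` of a sign vector. -/
def negCount {ι : Type*} [Fintype ι] (w : ι → ℤˣ) : ℕ :=
  (Finset.univ.filter fun i => w i = -1).card

theorem prod_eq_neg_one_pow_negCount {ι : Type*} [Fintype ι] (w : ι → ℤˣ) :
    ∏ i, w i = (-1) ^ negCount w := by
  have h : ∀ i, w i = if w i = -1 then -1 else 1 := fun i => by
    rcases Int.units_eq_one_or (w i) with h | h <;> simp [h]
  rw [Finset.prod_congr rfl fun i _ => h i, Finset.prod_ite]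
  simp [negCount]

theorem even_negCount_iff {ι : Type*} [Fintype ι] (w : ι → ℤˣ) :
    Even (negCount w) ↔ ∏ i, w i = 1 := by
  rw [prod_eq_neg_one_pow_negCount]
  constructor
  · exact fun h => h.neg_one_pow
  · intro h
    by_contra hodd
    rw [Nat.not_even_iff_odd] at hodd
    rw [hodd.neg_one_pow] at h
    exact absurd h (by decide)

theorem sum_eq_card_sub_negCount {ι : Type*} [Fintype ι] (w : ι → ℤˣ) :
    ∑ i, (w i : ℤ) = Fintype.card ι - 2 * negCount w := by
  have h : ∀ i, (w i : ℤ) = 1 - 2 * if w i = -1 then 1 else 0 := fun i => by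
    rcases Int.units_eq_one_or (w i) with h | h <;> simp [h]
  rw [Finset.sum_congr rfl fun i _ => h i, Finset.sum_sub_distrib, ← Finset.mul_sum,
    Finset.sum_boole]
  simp [negCount]

/-- Half the Hamming distance of two vertices. -/
def halfDist {k : ℕ} (u v : QuarterVertex k) : ℕ := negCount (fun i => u.1 i * v.1 i) / 2

theorem two_mul_halfDist {k : ℕ} (u v : QuarterVertex k) :
    2 * halfDist u v = negCount fun i => u.1 i * v.1 i := by
  refine Nat.two_mul_div_two_of_even ?_
  rw [even_negCount_iff, Finset.prod_mul_distrib, (even_negCount_iff u.1).1 u.2.2,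
    (even_negCount_iff v.1).1 v.2.2, one_mul]

theorem inner_eq_sub_halfDist {k : ℕ} (u v : QuarterVertex k) :
    ∑ i, ((u.1 i : ℤ) * (v.1 i : ℤ)) = k + 1 - 4 * halfDist u v := by
  have h := sum_eq_card_sub_negCount fun i => u.1 i * v.1 i
  rw [← two_mul_halfDist] at h
  simp only [Units.val_mul, Fintype.card_fin] at h
  rw [h]
  push_cast
  ring

theorem quarterGraph_adj_iff {k : ℕ} (u v : QuarterVertex k) :
    (quarterGraph k).Adj u v ↔ k + 1 = 4 * halfDist u v := by
  have h : (quarterGraph k).Adj u v ↔ ∑ i, ((u.1 i : ℤ) * (v.1 i : ℤ)) = 0 := Iff.rfl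
  rw [h, inner_eq_sub_halfDist]
  omega

theorem halfDist_self {k : ℕ} (u : QuarterVertex k) : halfDist u u = 0 := by
  simp [halfDist, negCount]

theorem halfDist_pos {k : ℕ} {u v : QuarterVertex k} (h : u ≠ v) : 0 < halfDist u v := by
  have h1 := two_mul_halfDist u v
  suffices 0 < negCount fun i => u.1 i * v.1 i by omega
  rw [negCount, Finset.card_pos]
  by_contra hne
  rw [Finset.not_nonempty_iff_eq_empty, Finset.filter_eq_empty_iff] at hne
  refine h (Subtype.ext (funext fun i => ?_))
  have := (Int.units_eq_one_or (u.1 i * v.1 i)).resolve_right (hne (Finset.mem_univ i))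
  rw [mul_eq_one_iff_eq_inv, Int.units_inv_eq_self] at this
  exact this

/-- The shared first entry `1` gives `e < 2 q`, so `q` is the only positive multiple of `q` that `e`
can equal. -/
theorem two_mul_halfDist_le {k : ℕ} (u v : QuarterVertex k) : 2 * halfDist u v ≤ k := by
  rw [two_mul_halfDist, negCount]
  have : (Finset.univ.filter fun i => u.1 i * v.1 i = -1) ⊆ Finset.univ.erase 0 := by
    intro i hi
    rw [Finset.mem_erase]
    refine ⟨?_, Finset.mem_univ i⟩
    rintro rfl
    have h2 := (Finset.mem_filter.1 hi).2
    rw [u.2.1, v.2.1] at h2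
    exact absurd h2 (by decide)
  refine (Finset.card_le_card this).trans ?_
  simp

/-- From `e * (e - 1).choose (q - 1) = q * e.choose q` with `q = p ^ s`: if `p` did not divide the
binomial coefficient, `q` would divide `e`. -/
theorem prime_dvd_choose_pred {p s e : ℕ} (hp : p.Prime) (he : e ≠ 0)
    (hlt : e < 2 * p ^ s) (hne : e ≠ p ^ s) : p ∣ (e - 1).choose (p ^ s - 1) := by
  obtain ⟨e, rfl⟩ := Nat.exists_eq_succ_of_ne_zero he
  obtain ⟨m, hm⟩ := Nat.exists_eq_succ_of_ne_zero (pow_pos hp.pos s).ne'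
  have h := Nat.add_one_mul_choose_eq e m
  have h1 : p ^ s ∣ (e + 1) * e.choose m := by
    rw [h, hm]
    exact Dvd.intro_left _ rfl
  have h2 : ¬ p ^ s ∣ e + 1 := by
    rintro ⟨c, hc⟩
    have hc2 : c < 2 := by
      by_contra hcon
      have : p ^ s * 2 ≤ p ^ s * c := Nat.mul_le_mul_left _ (by omega)
      omega
    interval_cases c
    · omega
    · omega
  rw [hm]
  simp only [Nat.succ_eq_add_one, Nat.add_sub_cancel]
  by_contra hcon
  exact h2 (((Nat.Prime.coprime_iff_not_dvd hp).2 hcon).pow_left s |>.dvd_of_dvd_mul_right h1)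

/-- The binomial coefficient `(e - 1).choose (q - 1)` for `e` half the Hamming distance. -/
noncomputable def distMatrix {k : ℕ} (q : ℕ) (u v : QuarterVertex k) : ℤ :=
  Ring.choose ((halfDist u v : ℤ) - 1) (q - 1)

theorem factorial_mul_choose_eq_prod (x : ℤ) (m : ℕ) :
    (m.factorial : ℤ) * Ring.choose x m = ∏ i ∈ Finset.range m, (x - i) := by
  have h := Ring.descPochhammer_eq_factorial_smul_choose x m
  rw [nsmul_eq_mul] at h
  rw [← h, ← descPochhammer_eval_eq_prod_range, ← Polynomial.aeval_eq_smeval,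
    Polynomial.coe_aeval_eq_eval]

/-- Here `Ring.choose (-1) (q - 1) = ±1`; truncated subtraction would give `0` once `q > 1`. -/
theorem distMatrix_self {k : ℕ} {p : ℕ} (hp : p.Prime) (q : ℕ) (u : QuarterVertex k) :
    ¬ (p : ℤ) ∣ distMatrix q u u := by
  have h := factorial_mul_choose_eq_prod (-1) (q - 1)
  have h2 : ∀ m : ℕ, ∏ i ∈ Finset.range m, ((-1 : ℤ) - i) = m.factorial * (-1) ^ m := by
    intro m
    induction m with
    | zero => simp
    | succ m ih =>
      rw [Finset.prod_range_succ, ih, Nat.factorial_succ]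
      push_cast
      ring
  rw [h2] at h
  have h3 := mul_left_cancel₀ (by exact_mod_cast Nat.factorial_ne_zero _) h
  rw [distMatrix, halfDist_self, Nat.cast_zero, zero_sub, h3]
  intro hd
  have := (Int.isUnit_iff.2 (neg_one_pow_eq_or ℤ (q - 1)))
  exact (Nat.prime_iff_prime_int.1 hp).not_isUnit (isUnit_of_dvd_unit hd this)

theorem distMatrix_dvd {k p s : ℕ} (hp : p.Prime) (hk : k = 4 * p ^ s - 1)
    {u v : QuarterVertex k} (hne : u ≠ v) (hadj : ¬ (quarterGraph k).Adj u v) :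
    (p : ℤ) ∣ distMatrix (p ^ s) u v := by
  have h1 := halfDist_pos hne
  have h2 := two_mul_halfDist_le u v
  rw [quarterGraph_adj_iff] at hadj
  have hq := pow_pos hp.pos s
  have h := prime_dvd_choose_pred (s := s) hp h1.ne' (by omega) (by omega)
  rw [distMatrix, ← Nat.cast_pred h1, Ring.choose_natCast]
  exact_mod_cast h

/-- The multilinear monomials in the coordinates other than the first. -/
def monomial {k : ℕ} (I : Finset (Fin k)) (v : QuarterVertex k) : ℚ :=
  ∏ i ∈ I, ((v.1 i.succ : ℤ) : ℚ)

/-- The span of the multilinear monomials of degree at most `m`. -/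
def lowDegree (k m : ℕ) : Submodule ℚ (QuarterVertex k → ℚ) :=
  Submodule.span ℚ (Set.range fun I : {I : Finset (Fin k) // I.card ≤ m} => monomial I.1)

theorem monomial_mem_lowDegree {k m : ℕ} {I : Finset (Fin k)} (h : I.card ≤ m) :
    monomial I ∈ lowDegree k m :=
  Submodule.subset_span ⟨⟨I, h⟩, rfl⟩

/-- Signs square to `1`, so multiplying by a coordinate inserts an index into the monomial or
deletes it. -/
theorem coord_mul_mem_lowDegree {k m : ℕ} (j : Fin k) {f : QuarterVertex k → ℚ}
    (hf : f ∈ lowDegree k m) :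
    (fun v => ((v.1 j.succ : ℤ) : ℚ) * f v) ∈ lowDegree k (m + 1) := by
  induction hf using Submodule.span_induction with
  | mem x h =>
    obtain ⟨⟨I, hI⟩, rfl⟩ := h
    by_cases hj : j ∈ I
    · have h : (fun v : QuarterVertex k => ((v.1 j.succ : ℤ) : ℚ) * monomial I v) =
          monomial (I.erase j) := by
        ext v
        rw [monomial, ← Finset.mul_prod_erase I _ hj, ← mul_assoc, ← Int.cast_mul,
          ← Units.val_mul, Int.units_mul_self, Units.val_one, Int.cast_one, one_mul, monomial]
      rw [h]
      exact monomial_mem_lowDegree ((Finset.card_erase_le).trans (by omega))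
    · have h : (fun v : QuarterVertex k => ((v.1 j.succ : ℤ) : ℚ) * monomial I v) =
          monomial (insert j I) := by
        ext v
        rw [monomial, monomial, Finset.prod_insert hj]
      rw [h]
      exact monomial_mem_lowDegree ((Finset.card_insert_le _ _).trans (by omega))
  | zero =>
    convert (lowDegree k (m + 1)).zero_mem using 1
    ext v
    simp
  | add x y _ _ hx hy =>
    convert (lowDegree k (m + 1)).add_mem hx hy using 1
    ext v
    simp [mul_add]
  | smul a x _ hx =>
    convert (lowDegree k (m + 1)).smul_mem a hx using 1
    ext v
    simp [mul_left_comm]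

theorem lowDegree_mono (k m : ℕ) : lowDegree k m ≤ lowDegree k (m + 1) := by
  refine Submodule.span_le.2 ?_
  rintro _ ⟨⟨I, hI⟩, rfl⟩
  exact monomial_mem_lowDegree (hI.trans m.le_succ)

theorem affine_mul_mem_lowDegree {k m : ℕ} (a : ℚ) (b : Fin k → ℚ) {f : QuarterVertex k → ℚ}
    (hf : f ∈ lowDegree k m) :
    (fun v => f v * (a + ∑ j, b j * ((v.1 j.succ : ℤ) : ℚ))) ∈ lowDegree k (m + 1) := by
  have h1 := (lowDegree k (m + 1)).smul_mem a (lowDegree_mono k m hf)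
  have h2 := (lowDegree k (m + 1)).sum_mem (t := Finset.univ) fun j _ =>
    (lowDegree k (m + 1)).smul_mem (b j) (coord_mul_mem_lowDegree j hf)
  convert (lowDegree k (m + 1)).add_mem h1 h2 using 1
  ext v
  simp only [Pi.add_apply, Pi.smul_apply, Finset.sum_apply, smul_eq_mul, mul_add, Finset.mul_sum]
  congr 1
  · ring
  · exact Finset.sum_congr rfl fun j _ => by ring

theorem halfDist_eq_affine {k : ℕ} (u v : QuarterVertex k) :
    (halfDist u v : ℚ) = k / 4 + ∑ j : Fin k, (-((u.1 j.succ : ℤ) : ℚ) / 4) * ((v.1 j.succ : ℤ) : ℚ) := by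
  have h := congrArg (Int.cast : ℤ → ℚ) (inner_eq_sub_halfDist u v)
  rw [Fin.sum_univ_succ, u.2.1, v.2.1] at h
  push_cast at h
  have h2 : ∑ j : Fin k, (-((u.1 j.succ : ℤ) : ℚ) / 4) * ((v.1 j.succ : ℤ) : ℚ) =
      -(1 / 4) * ∑ j : Fin k, ((u.1 j.succ : ℤ) : ℚ) * ((v.1 j.succ : ℤ) : ℚ) := by
    rw [Finset.mul_sum]
    exact Finset.sum_congr rfl fun j _ => by ring
  rw [h2]
  linarith

theorem prod_halfDist_mem_lowDegree {k : ℕ} (u : QuarterVertex k) (m : ℕ) :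
    (fun v => ∏ i ∈ Finset.range m, ((halfDist u v : ℚ) - 1 - i)) ∈ lowDegree k m := by
  induction m with
  | zero =>
    convert monomial_mem_lowDegree (k := k) (m := 0) (I := ∅) (by simp) using 1
    ext v
    simp [monomial]
  | succ m ih =>
    convert affine_mul_mem_lowDegree (k / 4 - 1 - m) (fun j => -((u.1 j.succ : ℤ) : ℚ) / 4) ih
      using 1
    ext v
    rw [Finset.prod_range_succ]
    congr 1
    rw [halfDist_eq_affine]
    ring

theorem distMatrix_mem_lowDegree {k : ℕ} (q : ℕ) (u : QuarterVertex k) :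
    (fun v => (distMatrix q u v : ℚ)) ∈ lowDegree k (q - 1) := by
  convert (lowDegree k (q - 1)).smul_mem (((q - 1).factorial : ℚ)⁻¹)
    (prod_halfDist_mem_lowDegree u (q - 1)) using 1
  ext v
  have h := congrArg (Int.cast : ℤ → ℚ) (factorial_mul_choose_eq_prod ((halfDist u v : ℤ) - 1) (q - 1))
  push_cast at h
  rw [Pi.smul_apply, ← h, smul_eq_mul, inv_mul_cancel_left₀, distMatrix]
  exact_mod_cast Nat.factorial_ne_zero _

theorem indepSet_card_le {k p s n : ℕ} (hp : p.Prime) (hk : k = 4 * p ^ s - 1)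
    {S : Finset (Fin n → QuarterVertex k)}
    (hS : (strongPower (quarterGraph k) n).IsIndepSet (S : Set (Fin n → QuarterVertex k))) :
    S.card ≤ Fintype.card {I : Finset (Fin k) // I.card ≤ p ^ s - 1} ^ n := by
  have := Fact.mk hp
  have h := fun u : QuarterVertex k =>
    (Submodule.mem_span_range_iff_exists_fun ℚ).1 (distMatrix_mem_lowDegree (p ^ s) u)
  choose X hX using h
  refine card_le_pow_of_factorization (quarterGraph k) p (distMatrix (p ^ s)) X
    (fun I v => monomial I.1 v) (fun u v => ?_) (fun u => distMatrix_self hp _ u)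
    (fun u v => distMatrix_dvd hp hk) hS
  rw [← congrFun (hX u) v]
  simp

/-- In the expansion of `(1 + 3) ^ (4 * m + 3)` over subsets, each subset of size at most `m`
contributes at least `3 ^ (3 * m + 3)`. -/
theorem card_lowDegree_mul_le (m : ℕ) :
    Fintype.card {I : Finset (Fin (4 * m + 3)) // I.card ≤ m} * 3 ^ (3 * m + 3) ≤
      4 ^ (4 * m + 3) := by
  have h := Finset.sum_pow_mul_eq_add_pow 1 3 (Finset.univ : Finset (Fin (4 * m + 3)))
  rw [Finset.card_univ, Fintype.card_fin, Finset.powerset_univ] at h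
  rw [show (4 : ℕ) = 1 + 3 from rfl, ← h, Fintype.card_subtype, ← smul_eq_mul, ← Finset.sum_const]
  refine (Finset.sum_le_sum fun I hI => ?_).trans
    (Finset.sum_le_sum_of_subset (Finset.filter_subset _ _))
  rw [one_pow, one_mul]
  have := (Finset.mem_filter.1 hI).2
  exact Nat.pow_le_pow_right (by norm_num) (by omega)

theorem logb_card_lowDegree_le (m : ℕ) :
    Real.logb 2 (Fintype.card {I : Finset (Fin (4 * m + 3)) // I.card ≤ m}) ≤
      0.856 * (4 * m + 3) := by
  have h := card_lowDegree_mul_le m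
  set r := Fintype.card {I : Finset (Fin (4 * m + 3)) // I.card ≤ m}
  have hr : 0 < r := Fintype.card_pos_iff.2 ⟨⟨∅, by simp⟩⟩
  have h' : (r : ℝ) * 3 ^ (3 * m + 3) ≤ 4 ^ (4 * m + 3) := by exact_mod_cast h
  have hr' : (0 : ℝ) < r := by exact_mod_cast hr
  have h2 := Real.logb_le_logb_of_le one_lt_two (by positivity) h'
  rw [Real.logb_mul hr'.ne' (by positivity), Real.logb_pow, Real.logb_pow,
    show (4 : ℝ) = 2 ^ 2 by norm_num, Real.logb_pow, Real.logb_self_eq_one one_lt_two] at h2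
  -- With `log 3 ≥ 11 / 7` the bound becomes `(23 m + 9) / 7`, below `0.856 (4 m + 3)`.
  have h3 : 11 ≤ 7 * Real.logb 2 3 := by
    have := Real.logb_le_logb_of_le one_lt_two (by positivity)
      (show (2 : ℝ) ^ 11 ≤ 3 ^ 7 by norm_num)
    rw [Real.logb_pow, Real.logb_pow, Real.logb_self_eq_one one_lt_two] at this
    norm_num at this
    linarith
  push_cast at h2
  have hm : (0 : ℝ) ≤ m := Nat.cast_nonneg m
  nlinarith [mul_nonneg hm (sub_nonneg.2 h3)]

theorem two_pow_le_card_quarterVertex (k : ℕ) : 2 ^ k ≤ Fintype.card (QuarterVertex (k + 1)) := by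
  -- The second entry is a parity bit that makes the product of all signs `1`.
  let f : (Fin k → ℤˣ) → QuarterVertex (k + 1) := fun g =>
    ⟨Fin.cons 1 (Fin.cons (∏ i, g i) g), by simp, by
      rw [← negCount, even_negCount_iff, Fin.prod_univ_succ, Fin.prod_univ_succ]
      simp [Int.units_mul_self]⟩
  have hf : Function.Injective f := by
    intro g g' h
    have h2 := congrArg Subtype.val h
    ext i
    have := congrFun h2 i.succ.succ
    simpa [f] using congrArg Units.val this
  simpa using Fintype.card_le_of_injective f hf

/-- Repeating `m` free signs twice and padding with `2 m + 4` entries `1` yields `2 ^ m` vertices,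
no two of which are orthogonal. -/
theorem exists_code (m : ℕ) : ∃ f : (Fin m → ℤˣ) → QuarterVertex (4 * m + 3),
    Function.Injective f ∧ ∀ g g', ¬ (quarterGraph (4 * m + 3)).Adj (f g) (f g') := by
  rw [show 4 * m + 3 = (m + m) + (2 * m + 3) by ring]
  let F : (Fin m → ℤˣ) → Fin ((m + m) + (2 * m + 3) + 1) → ℤˣ := fun g =>
    Fin.cons 1 (Fin.append (Fin.append g g) fun _ => 1)
  have hF : ∀ g, F g 0 = 1 ∧ Even (Finset.univ.filter fun i => F g i = -1).card := by
    refine fun g => ⟨rfl, ?_⟩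
    rw [← negCount, even_negCount_iff, Fin.prod_univ_succ]
    simp only [F, Fin.cons_zero, Fin.cons_succ, Fin.prod_univ_add, Fin.append_left,
      Fin.append_right, Int.units_mul_self, Finset.prod_const_one, mul_one]
  refine ⟨fun g => ⟨F g, hF g⟩, ?_, ?_⟩
  · intro g g' h
    have h2 := congrArg Subtype.val h
    ext i
    have := congrFun h2 (Fin.succ (Fin.castAdd _ (Fin.castAdd _ i)))
    simp only [F, Fin.cons_succ, Fin.append_left] at this
    exact congrArg Units.val this
  · intro g g' h
    have h2 : ∑ i, ((F g i : ℤ) * (F g' i : ℤ)) = 0 := h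
    rw [Fin.sum_univ_succ] at h2
    simp only [F, Fin.cons_zero, Fin.cons_succ, Fin.sum_univ_add, Fin.append_left,
      Fin.append_right] at h2
    -- The inner product is twice this sum plus `2 m + 4`, hence at least `4`.
    have h3 : -(m : ℤ) ≤ ∑ i, ((g i : ℤ) * (g' i : ℤ)) := by
      have : ∑ i : Fin m, (-1 : ℤ) ≤ ∑ i, ((g i : ℤ) * (g' i : ℤ)) :=
        Finset.sum_le_sum fun i _ => by
          rcases Int.units_eq_one_or (g i) with h | h <;>
            rcases Int.units_eq_one_or (g' i) with h' | h' <;> simp [h, h']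
      simpa using this
    simp at h2
    omega

end ZeroError

/-! ### The entangled protocol. -/

namespace ZeroError
open Matrix

section Protocol

variable {V A : Type*} [Fintype A] [AddCommGroup A]

/-- The vector of a tuple of vertices under a sign representation, twisted by a character. -/
def twist (σ : V → A → ℤˣ) {N : ℕ} (w : Fin N → V) (ψ : AddChar (Fin N → A) ℂ) :
    (Fin N → A) → ℂ :=
  fun x => ψ x * ∏ t, ((σ (w t) (x t) : ℤ) : ℂ)

/-- A common character cancels, so one orthogonal pair of coordinates makes the twisted vectors
orthogonal. -/
theorem star_twist_dotProduct_twist (σ : V → A → ℤˣ) {N : ℕ} (w w' : Fin N → V)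
    (ψ : AddChar (Fin N → A) ℂ) :
    star (twist σ w ψ) ⬝ᵥ twist σ w' ψ =
      ∏ t, ((∑ a, (σ (w t) a : ℤ) * (σ (w' t) a : ℤ) : ℤ) : ℂ) := by
  classical
  push_cast
  rw [Finset.prod_univ_sum, Fintype.piFinset_univ, dotProduct]
  refine Finset.sum_congr rfl fun x _ => ?_
  have h : star (ψ x) * ψ x = 1 := by
    rw [← starRingEnd_apply, ← AddChar.map_neg_eq_conj, ← AddChar.map_add_eq_mul, neg_add_cancel,
      AddChar.map_zero_eq_one]
  simp only [Pi.star_apply, twist, star_mul', star_prod, Finset.prod_mul_distrib]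
  have h2 : ∀ z : ℤ, star (z : ℂ) = z := fun z => by simp
  simp only [h2]
  linear_combination (∏ t, ((σ (w t) (x t) : ℤ) : ℂ)) * (∏ t, ((σ (w' t) (x t) : ℤ) : ℂ)) * h

/-- Completeness of the measurement: character orthogonality, together with entries of modulus `1`,
makes the twists of any one `w` an orthogonal basis. -/
theorem sum_twist_mul_star_twist (σ : V → A → ℤˣ) [DecidableEq A] {N : ℕ} (w : Fin N → V)
    (x y : Fin N → A) :
    ∑ ψ, twist σ w ψ x * star (twist σ w ψ y) =
      if x = y then (Fintype.card (Fin N → A) : ℂ) else 0 := by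
  have h : ∀ ψ : AddChar (Fin N → A) ℂ, twist σ w ψ x * star (twist σ w ψ y) =
      ψ (x - y) * ((∏ t, ((σ (w t) (x t) : ℤ) : ℂ)) * ∏ t, ((σ (w t) (y t) : ℤ) : ℂ)) := by
    intro ψ
    have h2 : ∀ z : ℤ, star (z : ℂ) = z := fun z => by simp
    simp only [twist, star_mul', star_prod, h2]
    rw [sub_eq_add_neg, AddChar.map_add_eq_mul, AddChar.map_neg_eq_conj, starRingEnd_apply]
    ring
  simp only [h]
  rw [← Finset.sum_mul, AddChar.sum_apply_eq_ite]
  by_cases hxy : x = y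
  · subst hxy
    rw [← Finset.prod_mul_distrib]
    have h3 : ∀ t, ((σ (w t) (x t) : ℤ) : ℂ) * ((σ (w t) (x t) : ℤ) : ℂ) = 1 := fun t => by
      rw [← Int.cast_mul, ← Units.val_mul, Int.units_mul_self, Units.val_one, Int.cast_one]
    simp [h3]
  · simp [hxy, sub_eq_zero]

/-- The product vector in `(ℂ^D)^{⊗ ℓ}`. -/
def productVec {ℓ : ℕ} {D : Type*} (g : Fin ℓ → D → ℂ) : (Fin ℓ → D) → ℂ := fun x => ∏ r, g r (x r)

theorem partialTrace_productVec {ℓ : ℕ} {D : Type*} [Fintype D] (k : Fin ℓ) (g : Fin ℓ → D → ℂ) :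
    ∃ C : ℂ, partialTrace k (vecMulVec (productVec g) (star (productVec g))) =
      C • vecMulVec (g k) (star (g k)) := by
  refine ⟨∑ z : {j // j ≠ k} → D, (∏ r : {j // j ≠ k}, g r (z r)) *
    star (∏ r : {j // j ≠ k}, g r (z r)), ?_⟩
  have h : ∀ a (z : {j // j ≠ k} → D), productVec g ((Equiv.funSplitAt k D).symm (a, z)) =
      g k a * ∏ r : {j // j ≠ k}, g r (z r) := by
    intro a z
    rw [productVec, Fintype.prod_eq_mul_prod_subtype_ne _ k]
    congr 1
    · simp
    · refine Finset.prod_congr rfl fun r _ => ?_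
      simp [r.2]
  ext a b
  simp only [partialTrace, Matrix.sum_apply, submatrix_apply, vecMulVec_apply, Pi.star_apply, h,
    Matrix.smul_apply, smul_eq_mul, Finset.sum_mul, star_mul']
  exact Finset.sum_congr rfl fun z _ => by ring

/-- A graph with a sign representation by vectors indexed by a finite abelian group `A` in which
adjacent vertices are orthogonal, and an independent set large enough to name the outcomes of a
measurement of `N` systems, transmits `card V ^ N` messages with `N + ℓ` uses. -/
theorem EntangledAchievable.of_representation [Fintype V] (G : SimpleGraph V) (σ : V → A → ℤˣ)
    (hσ : ∀ u v, G.Adj u v → ∑ a, (σ u a : ℤ) * (σ v a : ℤ) = 0) (N ℓ : ℕ)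
    (f : AddChar (Fin N → A) ℂ → V) (hf : Function.Injective f)
    (hfG : ∀ ψ ψ', ¬ G.Adj (f ψ) (f ψ')) :
    EntangledAchievable ℓ (strongPower G (N + ℓ)) (Fintype.card V ^ N) := by
  classical
  let K : ℂ := Fintype.card (Fin N → A)
  have hK : K ≠ 0 := Nat.cast_ne_zero.2 Fintype.card_ne_zero
  have hK0 : 0 ≤ (K ^ ℓ)⁻¹ := inv_nonneg.2 (pow_nonneg (Nat.cast_nonneg _) _)
  -- One factor `(K ^ ℓ)⁻¹` normalizes the maximally mixed state, the other the unnormalized basis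
  -- vectors.
  let T : (Fin N → V) → (Fin ℓ → AddChar (Fin N → A) ℂ) →
      Matrix (Fin ℓ → Fin N → A) (Fin ℓ → Fin N → A) ℂ := fun w ψ =>
    ((K ^ ℓ)⁻¹ * (K ^ ℓ)⁻¹) • vecMulVec (productVec fun r => twist σ w (ψ r))
      (star (productVec fun r => twist σ w (ψ r)))
  have hT : ∀ w ψ, (T w ψ).PosSemidef := fun w ψ =>
    (posSemidef_vecMulVec_self_star _).smul (mul_nonneg hK0 hK0)
  have key := EntangledAchievable.of_fintype (I := Fin N → V) (D := Fin N → A) ℓ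
    (strongPower G (N + ℓ))
    (fun w u => ∑ ψ, if u = Fin.append w (f ∘ ψ) then T w ψ else 0) ((K ^ ℓ)⁻¹ • 1) ?_ ?_ ?_ ?_ ?_
  · simpa using key
  · intro w u
    refine posSemidef_sum _ fun ψ _ => ?_
    split_ifs
    · exact hT w ψ
    · exact PosSemidef.zero
  · exact PosSemidef.one.smul hK0
  · rw [trace_smul, trace_one, Fintype.card_fun, Fintype.card_fin, smul_eq_mul, Nat.cast_pow]
    exact inv_mul_cancel₀ (pow_ne_zero _ hK)
  · intro w
    rw [Finset.sum_comm]
    simp only [Finset.sum_ite_eq', Finset.mem_univ, if_true]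
    ext x y
    simp only [T, Matrix.sum_apply, Matrix.smul_apply, smul_eq_mul, vecMulVec_apply, Pi.star_apply,
      productVec, star_prod]
    simp only [← Finset.prod_mul_distrib, ← Finset.mul_sum]
    have h := Finset.prod_univ_sum (fun _ : Fin ℓ => (Finset.univ : Finset (AddChar (Fin N → A) ℂ)))
      (fun r ψ => twist σ w ψ (x r) * star (twist σ w ψ (y r)))
    rw [Fintype.piFinset_univ] at h
    rw [← h]
    simp only [sum_twist_mul_star_twist]
    by_cases hxy : x = y
    · subst hxy
      simp only [if_true, Finset.prod_const, Finset.card_univ, Fintype.card_fin, one_apply_eq]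
      rw [mul_assoc]
      change (K ^ ℓ)⁻¹ * ((K ^ ℓ)⁻¹ * K ^ ℓ) = _
      rw [inv_mul_cancel₀ (pow_ne_zero _ hK)]
    · obtain ⟨r, hr⟩ := Function.ne_iff.1 hxy
      rw [one_apply_ne hxy, Finset.prod_eq_zero (Finset.mem_univ r) (if_neg hr)]
      simp
  · intro k w w' hw u v huv
    rw [partialTrace_sum, partialTrace_sum, Finset.sum_mul_sum]
    refine Finset.sum_eq_zero fun ψ _ => Finset.sum_eq_zero fun ψ' _ => ?_
    have h0 : partialTrace k (0 : Matrix (Fin ℓ → Fin N → A) (Fin ℓ → Fin N → A) ℂ) = 0 := by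
      simp [partialTrace]
    split_ifs with hu hv
    · subst hu hv
      have h := (eq_or_strongPower_adj_append G _ _ _ _).1 huv
      -- The last `ℓ` letters lie in an independent set, so confusable inputs name the same
      -- outcomes; the messages must then be adjacent in some coordinate.
      have hψ : ψ = ψ' := funext fun r =>
        hf (((eq_or_strongPower_adj G _ _).1 h.2 r).resolve_right (hfG _ _))
      subst hψ
      obtain ⟨t, ht⟩ := Function.ne_iff.1 hw
      have hadj := (((eq_or_strongPower_adj G _ _).1 h.1 t).resolve_left ht)
      have hsm : ∀ (c : ℂ) (M : Matrix (Fin ℓ → Fin N → A) (Fin ℓ → Fin N → A) ℂ),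
          partialTrace k (c • M) = c • partialTrace k M := fun c M => by
        simp only [partialTrace, Finset.smul_sum]
        rfl
      obtain ⟨C, hC⟩ := partialTrace_productVec k fun r => twist σ w (ψ r)
      obtain ⟨C', hC'⟩ := partialTrace_productVec k fun r => twist σ w' (ψ r)
      have hprod : vecMulVec (twist σ w (ψ k)) (star (twist σ w (ψ k))) *
          vecMulVec (twist σ w' (ψ k)) (star (twist σ w' (ψ k))) = 0 := by
        have hz : star (twist σ w (ψ k)) ⬝ᵥ twist σ w' (ψ k) = 0 := by
          rw [star_twist_dotProduct_twist]
          exact Finset.prod_eq_zero (Finset.mem_univ t) (by rw [hσ _ _ hadj, Int.cast_zero])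
        rw [vecMulVec_mul_vecMulVec, hz]
        simp
      simp only [T, hsm, hC, hC', smul_mul_assoc, mul_smul_comm, hprod, smul_zero]
    · rw [h0, mul_zero]
    · rw [h0, zero_mul]
    · rw [h0, zero_mul]

end Protocol

theorem entangledAchievable_quarterGraph (m N ℓ : ℕ) (hN : (4 * m + 4) ^ N ≤ 2 ^ m) :
    EntangledAchievable ℓ (strongPower (quarterGraph (4 * m + 3)) (N + ℓ))
      (Fintype.card (QuarterVertex (4 * m + 3)) ^ N) := by
  obtain ⟨f, hf, hfG⟩ := exists_code m
  have hcard : Fintype.card (AddChar (Fin N → Fin (4 * m + 3 + 1)) ℂ) ≤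
      Fintype.card (Fin m → ℤˣ) := by
    rw [AddChar.card_eq]
    simpa using hN
  obtain ⟨e⟩ := Function.Embedding.nonempty_of_card_le hcard
  exact EntangledAchievable.of_representation _ (fun u => u.1) (fun u v h => h) N ℓ (f ∘ e)
    (hf.comp e.injective) fun ψ ψ' => hfG _ _

end ZeroError

/-! ### Comparison of the two capacities. -/

namespace ZeroError

theorem exists_compoundCapacity {k p s ℓ : ℕ} (hp : p.Prime) (hk : k = 4 * p ^ s - 1)
    (hℓ : 1 ≤ ℓ) :
    ∃ c, IsCompoundCapacity ℓ (quarterGraph k) c ∧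
      c ≤ Real.logb 2 (Fintype.card {I : Finset (Fin k) // I.card ≤ p ^ s - 1}) := by
  have key := exists_growth_rate
    (fun n => {m : ℕ | ∃ S : Finset (Fin n → QuarterVertex k), S.card = m ∧
      ∀ _ : Fin ℓ, (strongPower (quarterGraph k) n).IsIndepSet (S : Set (Fin n → QuarterVertex k))})
    (Fintype.card {I : Finset (Fin k) // I.card ≤ p ^ s - 1}) ?_ ?_ ?_
  · obtain ⟨c, hc, hle, -⟩ := key
    exact ⟨c, hc, hle⟩
  · rintro n _ ⟨S, rfl, hS⟩
    exact indepSet_card_le hp hk (hS ⟨0, hℓ⟩)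
  · intro n
    exact ⟨{fun _ => ⟨1, by simp⟩}, by simp, fun _ => by simp⟩
  · rintro m n _ _ ⟨S, rfl, hS⟩ ⟨T, rfl, hT⟩
    obtain ⟨U, hU, hUi⟩ := exists_indepSet_mul (quarterGraph k) (hS ⟨0, hℓ⟩) (hT ⟨0, hℓ⟩)
    exact ⟨U, hU, fun _ => hUi⟩

theorem exists_entangledCapacity {V : Type*} [Fintype V] [Nonempty V] (G : SimpleGraph V) {ℓ : ℕ}
    (hℓ : 1 ≤ ℓ) :
    ∃ c, IsEntangledCapacity ℓ G c ∧ ∀ n x, n ≠ 0 → EntangledAchievable ℓ (strongPower G n) x →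
      1 ≤ x → Real.logb 2 x / n ≤ c := by
  have key := exists_growth_rate
    (fun n => {m : ℕ | EntangledAchievable ℓ (strongPower G n) m}) (Fintype.card V) ?_ ?_ ?_
  · obtain ⟨c, hc, -, hle⟩ := key
    exact ⟨c, hc, hle⟩
  · intro n x hx
    simpa using EntangledAchievable.le_card hℓ hx
  · intro n
    exact EntangledAchievable.one ℓ _
  · intro m n x y hx hy
    exact hx.mul hy

theorem capacity_separation {p s k ℓ : ℕ} (hp : p.Prime) (hk : k = 4 * p ^ s - 1) (hℓ : 1 ≤ ℓ)
    (h : (ℓ : ℝ) < (0.144 * (k : ℝ) - 1) / (0.856 * (k : ℝ)) *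
      (⌊((k : ℝ) - 3) / (4 * Real.logb 2 ((k : ℝ) + 1))⌋ : ℝ)) :
    ∃ c cStar : ℝ, IsCompoundCapacity ℓ (quarterGraph k) c ∧
      IsEntangledCapacity ℓ (quarterGraph k) cStar ∧ cStar > c := by
  obtain ⟨m, hm⟩ := Nat.exists_eq_succ_of_ne_zero (pow_pos hp.pos s).ne'
  obtain ⟨c, hc, hcle⟩ := exists_compoundCapacity hp hk hℓ
  have hpm : p ^ s - 1 = m := by omega
  have hkm : k = 4 * m + 3 := by omega
  rw [hpm] at hcle
  clear hk
  subst hkm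
  have : Nonempty (QuarterVertex (4 * m + 3)) := ⟨⟨1, by simp⟩⟩
  obtain ⟨d, hd, hdle⟩ := exists_entangledCapacity (quarterGraph (4 * m + 3)) hℓ
  refine ⟨c, d, hc, hd, ?_⟩
  have hlog : 0 < Real.logb 2 (((4 * m + 3 : ℕ) : ℝ) + 1) :=
    Real.logb_pos one_lt_two (by push_cast; linarith [Nat.cast_nonneg (α := ℝ) m])
  set z : ℝ := ((4 * m + 3 : ℕ) : ℝ) - 3 with hz
  have hzm : z = 4 * m := by rw [hz]; push_cast; ring
  have hfl : 0 ≤ ⌊z / (4 * Real.logb 2 (((4 * m + 3 : ℕ) : ℝ) + 1))⌋ :=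
    Int.floor_nonneg.2 (div_nonneg (by rw [hzm]; positivity) (by positivity))
  obtain ⟨N, hN⟩ := Int.eq_ofNat_of_zero_le hfl
  have hN' := Int.floor_le (z / (4 * Real.logb 2 (((4 * m + 3 : ℕ) : ℝ) + 1)))
  rw [hN, le_div_iff₀ (by positivity), hzm, Int.cast_natCast] at hN'
  rw [hN, Int.cast_natCast] at h
  -- The outcomes of one system, the characters of `(ℤ/(k + 1)) ^ N`, must fit into the independent
  -- set of `exists_code`.
  have hpow : (4 * m + 4) ^ N ≤ 2 ^ m := by
    have h1 : Real.logb 2 ((((4 * m + 3 : ℕ) : ℝ) + 1) ^ N) ≤ Real.logb 2 ((2 : ℝ) ^ m) := by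
      rw [Real.logb_pow, Real.logb_pow, Real.logb_self_eq_one one_lt_two]
      linarith
    rw [Real.logb_le_logb one_lt_two (by positivity) (by positivity)] at h1
    have h2 : (((4 * m + 4) ^ N : ℕ) : ℝ) ≤ ((2 ^ m : ℕ) : ℝ) := by
      push_cast at h1 ⊢
      rwa [add_assoc, show (3 : ℝ) + 1 = 4 by norm_num] at h1
    exact_mod_cast h2
  have hach := entangledAchievable_quarterGraph m N ℓ hpow
  have h1 := hdle (N + ℓ) _ (by omega) hach (Nat.one_le_pow _ _ Fintype.card_pos)
  have h2 : ((4 * m + 2 : ℕ) : ℝ) ≤ Real.logb 2 (Fintype.card (QuarterVertex (4 * m + 3))) := by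
    rw [Real.le_logb_iff_rpow_le one_lt_two (by exact_mod_cast Fintype.card_pos),
      Real.rpow_natCast]
    exact_mod_cast two_pow_le_card_quarterVertex (4 * m + 2)
  have h3 := hcle.trans (logb_card_lowDegree_le m)
  have hℓ0 : (1 : ℝ) ≤ ℓ := by exact_mod_cast hℓ
  have hN0 : (0 : ℝ) ≤ N := Nat.cast_nonneg N
  have hm0 : (0 : ℝ) ≤ m := Nat.cast_nonneg m
  refine h3.trans_lt (lt_of_lt_of_le ?_ h1)
  rw [lt_div_iff₀ (by push_cast; linarith), Nat.cast_pow, Real.logb_pow]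
  rw [div_mul_eq_mul_div, lt_div_iff₀ (by positivity)] at h
  push_cast at h h2 ⊢
  have h4 := mul_le_mul_of_nonneg_left h2 hN0
  linarith

/-- With `t = 10 * ℓ + 3` the fraction is at least `0.1` and the floor at least `t`. The summand `3`
starts the induction for `hgrow`, which fails at `t = 2`. -/
theorem lt_bound_of_three_pow (ℓ : ℕ) :
    (ℓ : ℝ) < (0.144 * ((4 * 3 ^ (10 * ℓ + 3) - 1 : ℕ) : ℝ) - 1) /
      (0.856 * ((4 * 3 ^ (10 * ℓ + 3) - 1 : ℕ) : ℝ)) *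
      (⌊(((4 * 3 ^ (10 * ℓ + 3) - 1 : ℕ) : ℝ) - 3) /
        (4 * Real.logb 2 (((4 * 3 ^ (10 * ℓ + 3) - 1 : ℕ) : ℝ) + 1))⌋ : ℝ) := by
  obtain ⟨t, ht⟩ : ∃ t, t = 10 * ℓ + 3 := ⟨_, rfl⟩
  rw [← ht]
  have ht3 : 3 ≤ t := by omega
  have hgrow : 1 + (2 + 2 * t) * t ≤ 3 ^ t := by
    clear ht
    induction t, ht3 using Nat.le_induction with
    | base => norm_num
    | succ n hn ih => rw [pow_succ]; nlinarith
  have hcast : ((4 * 3 ^ t - 1 : ℕ) : ℝ) = 4 * 3 ^ t - 1 := by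
    rw [Nat.cast_sub (by have := Nat.one_le_pow t 3 (by norm_num); omega)]
    push_cast
    ring
  have hgrow' : 1 + (2 + 2 * (t : ℝ)) * t ≤ 3 ^ t := by exact_mod_cast hgrow
  have ht3' : (3 : ℝ) ≤ t := by exact_mod_cast ht3
  have ht' : (t : ℝ) = 10 * ℓ + 3 := by rw [ht]; push_cast; ring
  set x : ℝ := 3 ^ t
  have hx : 25 ≤ x := by nlinarith
  rw [hcast, show 4 * x - 1 + 1 = 4 * x by ring]
  have hlog0 : 0 < Real.logb 2 (4 * x) := Real.logb_pos one_lt_two (by linarith)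
  have hlog : Real.logb 2 (4 * x) ≤ 2 + 2 * t := by
    have h3 : Real.logb 2 3 ≤ 2 := by
      rw [Real.logb_le_iff_le_rpow one_lt_two (by norm_num)]
      norm_num
    have h4 : Real.logb 2 4 = 2 := by
      rw [show (4 : ℝ) = 2 ^ 2 by norm_num, Real.logb_pow, Real.logb_self_eq_one one_lt_two]
      norm_num
    rw [Real.logb_mul (by norm_num) (by positivity), h4, Real.logb_pow]
    nlinarith
  have hfl : (t : ℝ) ≤ (⌊(4 * x - 1 - 3) / (4 * Real.logb 2 (4 * x))⌋ : ℝ) := by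
    have : (t : ℤ) ≤ ⌊(4 * x - 1 - 3) / (4 * Real.logb 2 (4 * x))⌋ := by
      rw [Int.le_floor, le_div_iff₀ (by positivity), Int.cast_natCast]
      have := mul_le_mul_of_nonneg_left hlog (by linarith : (0 : ℝ) ≤ t)
      nlinarith
    exact_mod_cast this
  have hfrac : 0.1 ≤ (0.144 * (4 * x - 1) - 1) / (0.856 * (4 * x - 1)) := by
    rw [le_div_iff₀ (by linarith)]
    linarith
  calc (ℓ : ℝ) < 0.1 * t := by rw [ht']; linarith
    _ ≤ _ := mul_le_mul hfrac hfl (by linarith) (by linarith)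

end ZeroError

theorem mainTheorem4 :
    (∀ p s k ℓ : ℕ, p.Prime → Odd p → k = 4 * p ^ s - 1 → 1 ≤ ℓ →
      (ℓ : ℝ) < (0.144 * (k : ℝ) - 1) / (0.856 * (k : ℝ)) *
        (⌊((k : ℝ) - 3) / (4 * Real.logb 2 ((k : ℝ) + 1))⌋ : ℝ) →
      ∃ c cStar : ℝ,
        ZeroError.IsCompoundCapacity ℓ (ZeroError.quarterGraph k) c ∧
        ZeroError.IsEntangledCapacity ℓ (ZeroError.quarterGraph k) cStar ∧
        cStar > c) ∧
    (∀ ℓ : ℕ, 1 ≤ ℓ → ∃ p s k : ℕ, p.Prime ∧ Odd p ∧ 1 ≤ s ∧ k = 4 * p ^ s - 1 ∧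
      ∃ c cStar : ℝ,
        ZeroError.IsCompoundCapacity ℓ (ZeroError.quarterGraph k) c ∧
        ZeroError.IsEntangledCapacity ℓ (ZeroError.quarterGraph k) cStar ∧
        cStar > c) := by
  refine ⟨fun p s k ℓ hp _ hk hℓ h => ZeroError.capacity_separation hp hk hℓ h, fun ℓ hℓ => ?_⟩
  exact ⟨3, 10 * ℓ + 3, _, Nat.prime_three, by decide, by omega, rfl,
    ZeroError.capacity_separation Nat.prime_three rfl hℓ (ZeroError.lt_bound_of_three_pow ℓ)⟩
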